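/- All spaces and operators are real. For a locally convex space $E$ let $\mathrm{eqc}(E^*)$ denote the collection of all equicontinuous weak-star compact subsets $K$ of the topological dual $E^*$; every $B\subseteq E$ is regarded as a family of functions $\varphi\mapsto\varphi(b)$ ($b\in B$) on each such $K$. A bounded subset $B\subseteq E$ is called: - tame if for every $K\in\mathrm{eqc}(E^*)$ the family $B$ on $K$ contains no independent sequence, where a sequence $f_n\colon K\to\mathbb R$ is independent if there are reals $a<b$ such that $\bigcap_{n\in P} f_n^{-1}(-\infty,a)\cap\bigcap_{n\in M} f_n^{-1}(b,\infty)\neq\emptyset$ for all disjoint finite sets $P,M\subset\mathbb N$; - Asplund (or NP) if for every $K\in\mathrm{eqc}(E^*)$ the family $B$ is fragmented on $K$: for every nonempty $A\subseteq K$ and every $\varepsilon>0$ there is a weak-star open $O\subseteq K$ such that $O\cap A\neq\emptyset$ and $|f(x)-f(y)|<\varepsilon$ for all $x,y\in O\cap A$ and all $f$ in the family; - DLP if for every $K\in\mathrm{eqc}(E^*)$ the family $B$ has the double limit property on $K$: for all sequences $(f_n)$ in the family and $(x_m)$ in $K$, the limits $\lim_n\lim_m f_n(x_m)$ and $\lim_m\lim_n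 f_n(x_m)$ are equal whenever both exist. A continuous linear operator $T\colon E\to F$ between locally convex spaces is called tame (resp. NP, DLP) if there is a neighbourhood $U$ of zero in $E$ such that $T(U)$ is a tame (resp. Asplund, DLP) subset of $F$. A Banach space $V$ is Rosenthal if every bounded sequence in $V$ has a weak Cauchy subsequence (i.e. a subsequence $(x_n)$ such that $(\varphi(x_n))$ converges for every $\varphi\in V^*$), and Asplund if the dual of every separable closed linear subspace of $V$ is norm separable. **Theorem.** Let $E$ be a locally convex space, $X$ a Banach space and $T\colon E\to X$ a continuous linear operator. If $T$ is tame (resp. NP, DLP), then $T$ factors through a Rosenthal (resp. Asplund, reflexive) Banach space: there are such a Banach space $V$ and continuous linear operators $u\colon E\to V$ and $j\colon V\to X$ with $T=j\circ u$. -/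

import Mathlib

open Filter Topology

universe u v

/-! ### Families of real functions -/

/-- A sequence of real functions on a set is (combinatorially) independent. -/
def IsIndependentSeq {K : Type*} (f : ℕ → K → ℝ) : Prop :=
  ∃ a b : ℝ, a < b ∧ ∀ P M : Finset ℕ, Disjoint P M →
    ∃ x : K, (∀ n ∈ P, f n x < a) ∧ (∀ n ∈ M, b < f n x)

/-- A (uniformly) bounded family of real functions is tame if it contains no independent
sequence. -/
def IsTameFamily {K : Type*} (F : Set (K → ℝ)) : Prop :=
  (∃ C : ℝ, ∀ f ∈ F, ∀ x, |f x| ≤ C) ∧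
    ¬ ∃ f : ℕ → K → ℝ, (∀ n, f n ∈ F) ∧ IsIndependentSeq f

/-- A family of real functions on a topological space is fragmented: every nonempty subset has,
for each `ε > 0`, a nonempty relatively open piece on which all members of the family
simultaneously oscillate by less than `ε`. -/
def IsFragmentedFamily {K : Type*} [TopologicalSpace K] (F : Set (K → ℝ)) : Prop :=
  ∀ A : Set K, A.Nonempty → ∀ ε > (0 : ℝ), ∃ O : Set K, IsOpen O ∧ (O ∩ A).Nonempty ∧
    ∀ f ∈ F, ∀ x ∈ O ∩ A, ∀ y ∈ O ∩ A, dist (f x) (f y) < ε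

/-- Grothendieck's double limit property: the two iterated limits are equal whenever both
exist. -/
def HasDLP {K : Type*} (F : Set (K → ℝ)) : Prop :=
  ∀ (f : ℕ → K → ℝ) (x : ℕ → K), (∀ n, f n ∈ F) →
    ∀ (α β : ℕ → ℝ) (a b : ℝ),
      (∀ n, Tendsto (fun m => f n (x m)) atTop (𝓝 (α n))) → Tendsto α atTop (𝓝 a) →
      (∀ m, Tendsto (fun n => f n (x m)) atTop (𝓝 (β m))) → Tendsto β atTop (𝓝 b) →
      a = b

/-! ### Small subsets of a locally convex space -/

section LCS

variable {E : Type*} [AddCommGroup E] [Module ℝ E] [TopologicalSpace E]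

/-- `K` belongs to `eqc(E*)`: it is a weak-star compact equicontinuous subset of the dual. -/
def IsEqc (K : Set (WeakDual ℝ E)) : Prop :=
  IsCompact K ∧ Equicontinuous (fun (φ : K) (x : E) => (φ : WeakDual ℝ E) x)

/-- The members of `B ⊆ E` viewed as functions on `K ⊆ E*`, through the canonical bilinear map.
The set `K` carries the weak-star topology. -/
def restrictTo (K : Set (WeakDual ℝ E)) (B : Set E) : Set (K → ℝ) :=
  (fun (x : E) (φ : K) => (φ : WeakDual ℝ E) x) '' B

/-- Tame subsets of `E`. -/
def IsTameSubset (B : Set E) : Prop :=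
  Bornology.IsVonNBounded ℝ B ∧ ∀ K : Set (WeakDual ℝ E), IsEqc K → IsTameFamily (restrictTo K B)

/-- Asplund (also called NP) subsets of `E`. -/
def IsAsplundSubset (B : Set E) : Prop :=
  Bornology.IsVonNBounded ℝ B ∧
    ∀ K : Set (WeakDual ℝ E), IsEqc K → IsFragmentedFamily (restrictTo K B)

/-- DLP subsets of `E`. -/
def IsDLPSubset (B : Set E) : Prop :=
  Bornology.IsVonNBounded ℝ B ∧ ∀ K : Set (WeakDual ℝ E), IsEqc K → HasDLP (restrictTo K B)

/-! ### Small operators -/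

variable {F : Type*} [AddCommGroup F] [Module ℝ F] [TopologicalSpace F]

/-- A tame operator maps some zero neighbourhood onto a tame subset. -/
def IsTameOperator (T : E →L[ℝ] F) : Prop :=
  ∃ U ∈ 𝓝 (0 : E), IsTameSubset (T '' U)

/-- An NP operator maps some zero neighbourhood onto an Asplund subset. -/
def IsNPOperator (T : E →L[ℝ] F) : Prop :=
  ∃ U ∈ 𝓝 (0 : E), IsAsplundSubset (T '' U)

/-- A DLP operator maps some zero neighbourhood onto a DLP subset. -/
def IsDLPOperator (T : E →L[ℝ] F) : Prop :=
  ∃ U ∈ 𝓝 (0 : E), IsDLPSubset (T '' U)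

/-- `T` factors through `V` by continuous linear operators `u : E → V` and `j : V → F`. -/
def FactorsThrough (T : E →L[ℝ] F) (V : Type*) [AddCommGroup V] [Module ℝ V]
    [TopologicalSpace V] : Prop :=
  ∃ (u : E →L[ℝ] V) (j : V →L[ℝ] F), T = j.comp u

end LCS

/-! ### Classes of Banach spaces -/

section Banach

variable (V : Type*) [NormedAddCommGroup V] [NormedSpace ℝ V]

/-- Rosenthal spaces: every bounded sequence has a weak Cauchy subsequence. -/
def IsRosenthalSpace : Prop :=
  ∀ x : ℕ → V, Bornology.IsBounded (Set.range x) →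
    ∃ k : ℕ → ℕ, StrictMono k ∧
      ∀ φ : StrongDual ℝ V, ∃ l : ℝ, Tendsto (fun n => φ (x (k n))) atTop (𝓝 l)

/-- Asplund spaces: the (norm) dual of every separable closed linear subspace is separable. -/
def IsAsplundSpace : Prop :=
  ∀ S : Submodule ℝ V, IsClosed (S : Set V) → TopologicalSpace.SeparableSpace S →
    TopologicalSpace.SeparableSpace (StrongDual ℝ S)

/-- Reflexive spaces: the canonical embedding into the bidual is onto. -/
def IsReflexiveSpace : Prop :=
  Function.Surjective (NormedSpace.inclusionInDoubleDual ℝ V)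

end Banach

/-! Shrink the neighbourhood to an absolutely convex `U'` and let `W` be its image under `T`. The
Davis–Figiel–Johnson–Pełczyński space `V` of `W` carries an injection `j` into `X` with `W` inside a
multiple of `j(B_V)`, so `T` lifts through `j`. The lift is continuous because it is bounded on
`U'`.

Two approximations move smallness from `W` to `V`. For each `ε` the set `j(B_V)` lies within `ε` of
a multiple of `W`, so up to `ε` it behaves on the dual ball of `X` like that multiple. Every
functional on `V` is a uniform limit on `B_V` of functionals `φ ∘ j`, so it is enough to test
against the dual ball.

Each class then needs one classical argument. Tame: Rosenthal's dichotomy, where independence in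
`j(B_V)` would give independence in `W`. NP: a fragmented family that factors through a second
countable Hausdorff space has countable nets, which makes duals of separable subspaces separable.
DLP: by Helly and Goldstine, a point of the bidual ball sent outside `X` gives a triangular array
contradicting the double limit property; since `closure (j(B_V))` stays in the range of `j`, the
space `V` is reflexive. -/

/-! ### Rosenthal's dichotomy. -/

section Oscillation

variable {K : Type*} {f : ℕ → K → ℝ} {a b : ℝ}

/-- Along the index set `N`, the values at `x` are infinitely often below `a` and infinitely often
above `b`. -/
def OscillatesAt (f : ℕ → K → ℝ) (a b : ℝ) (N : Set ℕ) (x : K) : Prop :=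
  {n ∈ N | f n x < a}.Infinite ∧ {n ∈ N | b < f n x}.Infinite

/-- On every infinite subset of the index set `N`, the sequence oscillates at some point of `D`. -/
def HereditarilyOscillates (f : ℕ → K → ℝ) (a b : ℝ) (D : Set K) (N : Set ℕ) : Prop :=
  ∀ M ⊆ N, M.Infinite → ∃ x ∈ D, OscillatesAt f a b M x

theorem OscillatesAt.of_finite_diff {N M : Set ℕ} {x : K} (h : OscillatesAt f a b N x)
    (hNM : (N \ M).Finite) : OscillatesAt f a b M x := by
  have key : ∀ p : ℕ → Prop, {n ∈ N | p n}.Infinite → {n ∈ M | p n}.Infinite := by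
    intro p hp hfin
    refine hp ((hfin.union hNM).subset ?_)
    rintro n ⟨hn, hpn⟩
    by_cases hM : n ∈ M
    · exact Or.inl ⟨hM, hpn⟩
    · exact Or.inr ⟨hn, hM⟩
  exact ⟨key _ h.1, key _ h.2⟩

/-- Diagonalisation: an increasing choice of one element from each member of a decreasing chain is
almost contained in every member. -/
theorem exists_infinite_of_hereditary (P : ℕ → Set ℕ → Prop)
    (hP : ∀ i N M, P i N → (M \ N).Finite → P i M)
    (h : ∀ i (N : Set ℕ), N.Infinite → ∃ M ⊆ N, M.Infinite ∧ P i M) :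
    ∃ N : Set ℕ, N.Infinite ∧ ∀ i, P i N := by
  choose! s hs hinf hPs using h
  let S : ℕ → Set ℕ := fun k => Nat.rec Set.univ (fun i N => s i N) k
  have hSi : ∀ k, (S k).Infinite := by
    intro k
    induction k with
    | zero => exact Set.infinite_univ
    | succ k ih => exact hinf k _ ih
  have hanti : Antitone S := antitone_nat_of_succ_le fun k => hs k _ (hSi k)
  obtain ⟨n, hn, hmem⟩ := extraction_forall_of_frequently
    (P := fun k m => m ∈ S k) fun k => Nat.frequently_atTop_iff_infinite.2 (hSi k)
  refine ⟨Set.range n, Set.infinite_range_of_injective hn.injective, fun i => ?_⟩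
  refine hP i (S (i + 1)) _ (hPs i _ (hSi i)) (((Set.finite_Iic i).image n).subset ?_)
  rintro _ ⟨⟨k, rfl⟩, hk⟩
  refine ⟨k, ?_, rfl⟩
  by_contra hki
  exact hk (hanti (Nat.succ_le_of_lt (by simpa using hki)) (hmem k))

/-- If no split exists, there is a decreasing chain of index sets where each step discards the
minimum `n k` and kills oscillation on one half (cut by `f (n k)`) of some `D`. One pair (`D`, side)
recurs infinitely often. A point of `D` oscillating along the corresponding `n k` lies in that half
for some such `k`, yet still oscillates along the next set of the chain. -/
theorem exists_split_of_hereditarilyOscillates {𝒟 : Set (Set K)} (h𝒟 : 𝒟.Finite) {N : Set ℕ}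
    (hN : N.Infinite) (hbig : ∀ D ∈ 𝒟, HereditarilyOscillates f a b D N) :
    ∃ n, ∃ M ⊆ N, M.Infinite ∧ ∀ D ∈ 𝒟,
      HereditarilyOscillates f a b (D ∩ {x | f n x < a}) M ∧
      HereditarilyOscillates f a b (D ∩ {x | b < f n x}) M := by
  by_contra! H
  let side : Bool → ℕ → Set K := fun s n => if s then {x | f n x < a} else {x | b < f n x}
  have step : ∀ S : {S : Set ℕ // S ⊆ N ∧ S.Infinite}, ∃ S' : {S : Set ℕ // S ⊆ N ∧ S.Infinite},
      ∃ c : 𝒟 × Bool, S'.1 ⊆ S.1 \ {sInf S.1} ∧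
        ∀ x ∈ c.1.1 ∩ side c.2 (sInf S.1), ¬ OscillatesAt f a b S'.1 x := by
    rintro ⟨S, hSN, hS⟩
    have hS' : (S \ {sInf S}).Infinite := hS.sdiff (Set.finite_singleton _)
    obtain ⟨D, hD, hDS⟩ := H (sInf S) (S \ {sInf S}) (Set.sdiff_subset.trans hSN) hS'
    by_cases hA : HereditarilyOscillates f a b (D ∩ {x | f (sInf S) x < a}) (S \ {sInf S})
    · have hB := hDS hA
      simp only [HereditarilyOscillates, not_forall, not_exists, not_and] at hB
      obtain ⟨M, hM, hMi, hMx⟩ := hB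
      exact ⟨⟨M, hM.trans (Set.sdiff_subset.trans hSN), hMi⟩, ⟨⟨D, hD⟩, false⟩, hM,
        fun x hx => hMx x (by simpa [side] using hx)⟩
    · simp only [HereditarilyOscillates, not_forall, not_exists, not_and] at hA
      obtain ⟨M, hM, hMi, hMx⟩ := hA
      exact ⟨⟨M, hM.trans (Set.sdiff_subset.trans hSN), hMi⟩, ⟨⟨D, hD⟩, true⟩, hM,
        fun x hx => hMx x (by simpa [side] using hx)⟩
  choose next c hnext hc using step
  let S : ℕ → {S : Set ℕ // S ⊆ N ∧ S.Infinite} :=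
    fun k => Nat.rec ⟨N, subset_rfl, hN⟩ (fun _ T => next T) k
  have hSs : ∀ k, (S (k + 1)).1 ⊆ (S k).1 \ {sInf (S k).1} := fun k => hnext (S k)
  have hanti : Antitone fun k => (S k).1 :=
    antitone_nat_of_succ_le fun k => (hSs k).trans Set.sdiff_subset
  let n : ℕ → ℕ := fun k => sInf (S k).1
  have hnS : ∀ k, n k ∈ (S k).1 := fun k => Nat.sInf_mem (S k).2.2.nonempty
  have hn : StrictMono n := strictMono_nat_of_lt_succ fun k => by
    have h1 := hSs k (hnS (k + 1))
    exact lt_of_le_of_ne (Nat.sInf_le h1.1) (fun h => h1.2 h.symm)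
  have : Finite 𝒟 := h𝒟
  obtain ⟨⟨⟨D, hD⟩, s⟩, hfib⟩ := Finite.exists_infinite_fiber fun k => c (S k)
  have hfib' := Set.infinite_coe_iff.1 hfib
  set I := (fun k => c (S k)) ⁻¹' {(⟨D, hD⟩, s)} with hI
  have hsub : n '' I ⊆ N := by
    rintro _ ⟨k, -, rfl⟩
    exact (S k).2.1 (hnS k)
  obtain ⟨x, hxD, hx⟩ := hbig D hD (n '' I) hsub (hfib'.image hn.injective.injOn)
  have hside : ∃ k ∈ I, x ∈ side s (n k) := by
    cases s
    · obtain ⟨_, ⟨k, hk, rfl⟩, hlt⟩ := hx.2.nonempty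
      exact ⟨k, hk, by simpa [side] using hlt⟩
    · obtain ⟨_, ⟨k, hk, rfl⟩, hlt⟩ := hx.1.nonempty
      exact ⟨k, hk, by simpa [side] using hlt⟩
  obtain ⟨k, hk, hkx⟩ := hside
  have hk' : c (S k) = (⟨D, hD⟩, s) := hk
  refine hc (S k) x ?_ (hx.of_finite_diff (((Set.finite_Iic k).image n).subset ?_))
  · rw [hk']
    exact ⟨hxD, hkx⟩
  · rintro _ ⟨⟨m, -, rfl⟩, hm⟩
    refine ⟨m, ?_, rfl⟩
    by_contra hmk
    exact hm (hanti (Nat.succ_le_of_lt (by simpa using hmk)) (hnS m))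

/-- Repeated splitting grows a binary tree of sets. All of them oscillate hereditarily, so none is
empty, and the branches realise every sign pattern. -/
theorem exists_independent_of_hereditarilyOscillates (hab : a < b) {N : Set ℕ} (hN : N.Infinite)
    (h : HereditarilyOscillates f a b Set.univ N) :
    ∃ n : ℕ → ℕ, IsIndependentSeq fun k => f (n k) := by
  let State := {p : Set (Set K) × Set ℕ // p.1.Finite ∧ p.2.Infinite ∧
    ∀ D ∈ p.1, HereditarilyOscillates f a b D p.2}
  have step : ∀ p : State, ∃ q : State, ∃ n : ℕ, ∀ D ∈ p.1.1,
      D ∩ {x | f n x < a} ∈ q.1.1 ∧ D ∩ {x | b < f n x} ∈ q.1.1 := by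
    rintro ⟨⟨𝒟, M⟩, hfin, hM, hbig⟩
    obtain ⟨n, L, -, hL, hs⟩ := exists_split_of_hereditarilyOscillates hfin hM hbig
    refine ⟨⟨⟨(fun D => D ∩ {x | f n x < a}) '' 𝒟 ∪ (fun D => D ∩ {x | b < f n x}) '' 𝒟, L⟩,
      (hfin.image _).union (hfin.image _), hL, ?_⟩, n, fun D hD =>
        ⟨Or.inl ⟨D, hD, rfl⟩, Or.inr ⟨D, hD, rfl⟩⟩⟩
    rintro _ (⟨D, hD, rfl⟩ | ⟨D, hD, rfl⟩)
    · exact (hs D hD).1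
    · exact (hs D hD).2
  choose next n hn using step
  let S : ℕ → State := fun k => Nat.rec
    ⟨⟨{Set.univ}, N⟩, Set.finite_singleton _, hN, by simpa using h⟩ (fun _ T => next T) k
  refine ⟨fun k => n (S k), a, b, hab, fun P M hPM => ?_⟩
  have key : ∀ k, ∃ D ∈ (S k).1.1, ∀ x ∈ D, ∀ i < k,
      (i ∈ P → f (n (S i)) x < a) ∧ (i ∈ M → b < f (n (S i)) x) := by
    intro k
    induction k with
    | zero => exact ⟨Set.univ, rfl, fun x _ i hi => absurd hi (Nat.not_lt_zero i)⟩
    | succ k ih =>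
      obtain ⟨D, hD, hDx⟩ := ih
      by_cases hk : k ∈ P
      · refine ⟨_, (hn (S k) D hD).1, fun x hx i hi => ?_⟩
        rcases Nat.lt_succ_iff_lt_or_eq.1 hi with hi | rfl
        · exact hDx x hx.1 i hi
        · exact ⟨fun _ => hx.2, fun hM => absurd hM (Finset.disjoint_left.1 hPM hk)⟩
      · refine ⟨_, (hn (S k) D hD).2, fun x hx i hi => ?_⟩
        rcases Nat.lt_succ_iff_lt_or_eq.1 hi with hi | rfl
        · exact hDx x hx.1 i hi
        · exact ⟨fun hP => absurd hP hk, fun _ => hx.2⟩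
  obtain ⟨D, hD, hDx⟩ := key ((P ∪ M).sup id + 1)
  have hS := (S ((P ∪ M).sup id + 1)).2
  obtain ⟨x, hx, -⟩ := hS.2.2 D hD _ subset_rfl hS.2.1
  have hlt : ∀ i ∈ P ∪ M, i < (P ∪ M).sup id + 1 := fun i hi =>
    Nat.lt_succ_of_le (Finset.le_sup (f := id) hi)
  exact ⟨x, fun i hi => (hDx x hx i (hlt i (Finset.mem_union_left _ hi))).1 hi,
    fun i hi => (hDx x hx i (hlt i (Finset.mem_union_right _ hi))).2 hi⟩

/-- **Rosenthal's dichotomy**: a pointwise bounded sequence of real functions has a pointwise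
convergent subsequence, or else an independent sequence can be drawn from it. -/
theorem exists_tendsto_subseq_or_independent (hf : ∀ x, ∃ C, ∀ n, |f n x| ≤ C) :
    (∃ k : ℕ → ℕ, StrictMono k ∧ ∀ x, ∃ l, Tendsto (fun n => f (k n) x) atTop (𝓝 l)) ∨
      ∃ n : ℕ → ℕ, IsIndependentSeq fun k => f (n k) := by
  obtain ⟨e, he⟩ := exists_surjective_nat (ℚ × ℚ)
  -- Rational levels suffice: a bounded sequence that crosses no rational interval infinitely often
  -- converges.
  by_cases h : ∀ i (N : Set ℕ), N.Infinite → ∃ M ⊆ N, M.Infinite ∧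
      ((e i).1 < (e i).2 → ∀ x, ¬ OscillatesAt f (e i).1 (e i).2 M x)
  · left
    obtain ⟨N, hN, hosc⟩ := exists_infinite_of_hereditary
      (fun i M => (e i).1 < (e i).2 → ∀ x, ¬ OscillatesAt f (e i).1 (e i).2 M x)
      (fun i N M hi hfin hlt x hx => hi hlt x (hx.of_finite_diff hfin)) h
    have hk : StrictMono (Nat.nth (· ∈ N)) := Nat.nth_strictMono hN
    have hmem : ∀ m, Nat.nth (· ∈ N) m ∈ N := Nat.nth_mem_of_infinite hN
    refine ⟨Nat.nth (· ∈ N), hk, fun x => ?_⟩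
    obtain ⟨C, hC⟩ := hf x
    refine tendsto_of_no_upcrossings (s := Set.range ((↑) : ℚ → ℝ)) Rat.denseRange_cast ?_
      (isBoundedUnder_of ⟨C, fun n => (abs_le.1 (hC _)).2⟩)
      (isBoundedUnder_of ⟨-C, fun n => (abs_le.1 (hC _)).1⟩)
    rintro _ ⟨p, rfl⟩ _ ⟨q, rfl⟩ hpq ⟨h1, h2⟩
    obtain ⟨i, hi⟩ := he (p, q)
    refine hosc i (by simpa [hi] using hpq) x ?_
    rw [hi]
    rw [Nat.frequently_atTop_iff_infinite] at h1 h2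
    refine ⟨(h1.image hk.injective.injOn).mono ?_, (h2.image hk.injective.injOn).mono ?_⟩ <;>
    · rintro _ ⟨m, hm, rfl⟩
      exact ⟨hmem m, hm⟩
  · right
    push Not at h
    obtain ⟨i, N, hN, hi⟩ := h
    refine exists_independent_of_hereditarilyOscillates (a := (e i).1) (b := (e i).2) ?_ hN ?_
    · obtain ⟨hlt, -⟩ := hi N subset_rfl hN
      exact_mod_cast hlt
    · intro M hM hMi
      obtain ⟨-, x, hx⟩ := hi M hM hMi
      exact ⟨x, trivial, hx⟩

end Oscillation

/-! ### The diagonal of an `ℓ²`-sum of renormings. -/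

section DiagonalSpace

open scoped ENNReal

variable {X : Type v} [NormedAddCommGroup X] [NormedSpace ℝ X]
  {Y : ℕ → Type v} [∀ n, NormedAddCommGroup (Y n)] [∀ n, NormedSpace ℝ (Y n)]

/-- A functional on an `ℓ²`-sum is uniformly small on the tails of the unit ball. -/
theorem lp.exists_finset_apply_sub_sum_single_le (g : StrongDual ℝ (lp Y 2)) {ε : ℝ} (hε : 0 < ε) :
    ∃ s : Finset ℕ, ∀ z : lp Y 2, ‖z‖ ≤ 1 → g (z - ∑ i ∈ s, lp.single 2 i (z i)) ≤ ε := by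
  have h2 : (0 : ℝ) < (2 : ℝ≥0∞).toReal := by norm_num
  set c := ‖g‖ with hc
  have hc0 : 0 ≤ c := norm_nonneg g
  set t := ε / (c + 1) with ht
  have ht0 : 0 < t := by positivity
  have htc : t * (c + 1) = ε := by rw [ht]; field_simp
  set η := t * ε / 2 with hη
  have hη0 : 0 < η := by positivity
  -- Truncate a nearly norming `z₀` to `s` and add `t` times a tail `y'`. The norm is at most `1 +
  -- t² / 2`, so `t * g y'` is at most `η + c * t² / 2`. Both terms are at most `t * ε / 2` by the
  -- choice of `η` and `t`.
  obtain ⟨z₀, hz₀, hgz₀⟩ : ∃ z : lp Y 2, ‖z‖ ≤ 1 ∧ c - η < g z := by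
    obtain ⟨z, hz, hgz⟩ := g.exists_lt_apply_of_lt_opNorm (r := c - η) (by linarith)
    rcases le_total 0 (g z) with h | h
    · exact ⟨z, hz.le, by rwa [Real.norm_of_nonneg h] at hgz⟩
    · exact ⟨-z, by simpa using hz.le, by rwa [Real.norm_of_nonpos h, ← map_neg] at hgz⟩
  have hlim := (g.continuous.tendsto z₀).comp (lp.hasSum_single (by norm_num) z₀)
  obtain ⟨s, hs⟩ := (hlim.eventually (lt_mem_nhds hgz₀)).exists
  refine ⟨s, fun y hy => ?_⟩
  set P : lp Y 2 → lp Y 2 := fun z => ∑ i ∈ s, lp.single 2 i (z i) with hP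
  have hPapp : ∀ (z : lp Y 2) (i : ℕ), i ∈ s → P z i = z i := by
    intro z i hi
    simp only [hP, lp.coeFn_sum, lp.coeFn_single, Finset.sum_apply, Finset.sum_pi_single, if_pos hi]
  have hPcongr : ∀ z z' : lp Y 2, (∀ i ∈ s, z i = z' i) → P z = P z' := by
    intro z z' h
    exact Finset.sum_congr rfl fun i hi => by rw [h i hi]
  set y' := y - P y with hy'
  have hy'n : ‖y'‖ ≤ 1 := by
    have h := lp.norm_compl_sum_single h2 y s
    have h0 : 0 ≤ ∑ i ∈ s, ‖y i‖ ^ (2 : ℝ≥0∞).toReal := Finset.sum_nonneg fun i _ => by positivity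
    simp only [ENNReal.toReal_ofNat, Real.rpow_two] at h h0
    change ‖y'‖ ^ 2 = _ at h
    nlinarith [norm_nonneg y, norm_nonneg y']
  set w := P z₀ + t • y' with hw
  have hwi : ∀ i ∈ s, w i = z₀ i := by
    intro i hi
    have h1 : y' i = 0 := by
      rw [hy', lp.coeFn_sub, Pi.sub_apply, hPapp y i hi, sub_self]
    rw [hw, lp.coeFn_add, lp.coeFn_smul, Pi.add_apply, Pi.smul_apply, h1, hPapp z₀ i hi, smul_zero,
      add_zero]
  have hwn : ‖w‖ ^ 2 ≤ 1 + t ^ 2 := by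
    have h := lp.norm_sub_norm_compl_sub_single h2 w s
    have hPw : w - ∑ i ∈ s, lp.single 2 i (w i) = t • y' := by
      change w - P w = _
      rw [hPcongr w z₀ hwi, hw, add_sub_cancel_left]
    have hz := lp.sum_rpow_le_norm_rpow h2 z₀ s
    rw [hPw, Finset.sum_congr rfl fun i hi => by rw [hwi i hi], norm_smul, Real.norm_of_nonneg ht0.le]
      at h
    simp only [ENNReal.toReal_ofNat, Real.rpow_two] at h hz
    have : ‖z₀‖ ^ 2 ≤ 1 := by nlinarith [norm_nonneg z₀]
    have : ‖y'‖ ^ 2 ≤ 1 := by nlinarith [norm_nonneg y']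
    nlinarith [sq_nonneg t]
  have hwn' : ‖w‖ ≤ 1 + t ^ 2 / 2 := by
    nlinarith [norm_nonneg w, sq_nonneg (t ^ 2), sq_nonneg t]
  have hgw : g w ≤ c * (1 + t ^ 2 / 2) :=
    (le_abs_self _).trans ((g.le_opNorm w).trans (mul_le_mul_of_nonneg_left hwn' hc0))
  have hgw' : g w = g (P z₀) + t * g y' := by simp [hw]
  have hs' : c - η < g (P z₀) := hs
  have : t * g y' ≤ t * ε := by
    rw [hη] at hs'
    nlinarith
  exact le_of_mul_le_mul_left this ht0

/-- The vectors of an `ℓ²`-sum of renormings of `X` which are constant sequences. -/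
def diagonalSubmodule (e : ∀ n, X ≃L[ℝ] Y n) : Submodule ℝ (lp Y 2) where
  carrier := {z | ∀ n, z n = e n ((e 0).symm (z 0))}
  add_mem' {y z} hy hz n := by
    simp only [Set.mem_ofPred_eq] at hy hz
    rw [lp.coeFn_add, Pi.add_apply, Pi.add_apply, map_add, map_add, ← hy n, ← hz n]
  zero_mem' n := by simp
  smul_mem' c z hz n := by
    simp only [Set.mem_ofPred_eq] at hz
    rw [lp.coeFn_smul, Pi.smul_apply, Pi.smul_apply, map_smul, map_smul, ← hz n]

/-- The common value of a constant sequence. -/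
noncomputable def diagonalValue (e : ∀ n, X ≃L[ℝ] Y n) : diagonalSubmodule e →L[ℝ] X :=
  (e 0).symm.toContinuousLinearMap.comp ((lp.evalCLM ℝ Y 2 0).comp (diagonalSubmodule e).subtypeL)

variable (e : ∀ n, X ≃L[ℝ] Y n)

theorem coe_diagonalSubmodule_apply (z : diagonalSubmodule e) (n : ℕ) :
    (z : lp Y 2) n = e n (diagonalValue e z) := z.2 n

theorem diagonalValue_injective : Function.Injective (diagonalValue e) := by
  intro y z h
  ext n
  rw [coe_diagonalSubmodule_apply, coe_diagonalSubmodule_apply, h]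

theorem isClosed_diagonalSubmodule : IsClosed (diagonalSubmodule e : Set (lp Y 2)) := by
  have : (diagonalSubmodule e : Set (lp Y 2)) =
      ⋂ n, {z | lp.evalCLM ℝ Y 2 n z = e n ((e 0).symm (lp.evalCLM ℝ Y 2 0 z))} := by
    ext z
    simp only [Set.mem_iInter]
    rfl
  rw [this]
  exact isClosed_iInter fun n => isClosed_eq (by fun_prop) (by fun_prop)

theorem sum_norm_diagonalValue_sq_le (z : diagonalSubmodule e) (s : Finset ℕ) :
    ∑ n ∈ s, ‖e n (diagonalValue e z)‖ ^ 2 ≤ ‖z‖ ^ 2 := by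
  have h := lp.sum_rpow_le_norm_rpow (by norm_num) (z : lp Y 2) s
  simp only [ENNReal.toReal_ofNat, Real.rpow_two, coe_diagonalSubmodule_apply] at h
  exact h

theorem exists_diagonalValue_eq {x : X} {C : ℝ} (hC : 0 ≤ C)
    (hx : ∀ s : Finset ℕ, ∑ n ∈ s, ‖e n x‖ ^ 2 ≤ C ^ 2) :
    ∃ z : diagonalSubmodule e, diagonalValue e z = x ∧ ‖z‖ ≤ C := by
  have hmem : Memℓp (fun n => e n x) 2 := memℓp_gen' (C := C ^ 2) fun s => by
    simpa only [ENNReal.toReal_ofNat, Real.rpow_two] using hx s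
  refine ⟨⟨⟨fun n => e n x, hmem⟩, fun n => by simp⟩, by simp [diagonalValue, lp.evalCLM], ?_⟩
  refine lp.norm_le_of_forall_sum_le (f := ⟨fun n => e n x, hmem⟩) (by norm_num) hC fun s => ?_
  simpa only [ENNReal.toReal_ofNat, Real.rpow_two] using hx s

/-- A Hahn–Banach extension to the `ℓ²`-sum is nearly determined by finitely many coordinates, and
on the diagonal each coordinate is a functional of the common value in `X`. -/
theorem exists_dual_apply_sub_diagonalValue_le (ψ : StrongDual ℝ (diagonalSubmodule e)) {ε : ℝ}
    (hε : 0 < ε) : ∃ φ : StrongDual ℝ X, ∀ z, ‖z‖ ≤ 1 → ψ z - φ (diagonalValue e z) ≤ ε := by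
  obtain ⟨g, hg⟩ := StrongDual.exists_extension (diagonalSubmodule e) ψ
  obtain ⟨s, hs⟩ := lp.exists_finset_apply_sub_sum_single_le g hε
  refine ⟨∑ n ∈ s, g.comp ((lp.singleContinuousLinearMap ℝ Y 2 n).comp
    (e n).toContinuousLinearMap), fun z hz => ?_⟩
  have h := hs z hz
  rw [map_sub, hg, map_sum] at h
  simpa [sum_apply, coe_diagonalSubmodule_apply] using h

end DiagonalSpace

/-! ### The interpolation space. -/

section Interpolation

open scoped Pointwise

variable {X : Type v} [NormedAddCommGroup X] [NormedSpace ℝ X]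

/-- A copy of `X`, to be equipped with another norm. -/
def Renorm (X : Type v) : Type v := X

theorem exists_renorming (p : Seminorm ℝ X) {c C : ℝ} (hp : ∀ x, p x ≤ C * ‖x‖)
    (hp' : ∀ x, ‖x‖ ≤ c * p x) :
    ∃ (Y : Type v) (_ : NormedAddCommGroup Y) (_ : NormedSpace ℝ Y) (e : X ≃L[ℝ] Y),
      ∀ x, ‖e x‖ = p x := by
  let : AddCommGroup (Renorm X) := inferInstanceAs (AddCommGroup X)
  let : Module ℝ (Renorm X) := inferInstanceAs (Module ℝ X)
  let : Norm (Renorm X) := ⟨fun x => p x⟩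
  have core : NormedSpace.Core ℝ (Renorm X) :=
    { norm_nonneg := fun x => apply_nonneg p x
      norm_smul := fun c x => map_smul_eq_mul p c x
      norm_triangle := fun x y => map_add_le_add p x y
      norm_eq_zero_iff := fun x => by
        refine ⟨fun h => ?_, fun h => by rw [h]; exact map_zero p⟩
        have h0 : p x = 0 := h
        have h1 := hp' x
        rw [h0, mul_zero] at h1
        exact norm_le_zero_iff.1 h1 }
  let : NormedAddCommGroup (Renorm X) := NormedAddCommGroup.ofCore core
  let : NormedSpace ℝ (Renorm X) := NormedSpace.ofCore core
  let e₀ : X ≃ₗ[ℝ] Renorm X := LinearEquiv.refl ℝ X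
  have h1 : Continuous e₀ := AddMonoidHomClass.continuous_of_bound e₀ C hp
  have h2 : Continuous e₀.symm := AddMonoidHomClass.continuous_of_bound e₀.symm c hp'
  exact ⟨Renorm X, inferInstance, inferInstance, ⟨e₀, h1, h2⟩, fun x => rfl⟩

/-- The properties of the Davis–Figiel–Johnson–Pełczyński space of a set `W`, mapped into the
ambient space by `j`. -/
structure IsInterpolation {V X : Type*} [NormedAddCommGroup V] [NormedSpace ℝ V]
    [NormedAddCommGroup X] [NormedSpace ℝ X] (W : Set X) (j : V →L[ℝ] X) : Prop where
  injective : Function.Injective j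
  exists_preimage : ∃ C, ∀ x ∈ W, ∃ v, j v = x ∧ ‖v‖ ≤ C
  exists_approx : ∀ ε > 0, ∃ c > (0 : ℝ), ∀ v, ‖v‖ ≤ 1 → ∃ w ∈ W, ‖j v - c • w‖ ≤ ε
  exists_dual_approx : ∀ (ψ : StrongDual ℝ V), ∀ ε > 0, ∃ φ : StrongDual ℝ X,
    ∀ v, ‖v‖ ≤ 1 → ψ v - φ (j v) ≤ ε
  closure_image_subset : closure (j '' Metric.closedBall 0 1) ⊆ Set.range j

/-- The Davis–Figiel–Johnson–Pełczyński construction. -/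
theorem exists_isInterpolation [CompleteSpace X] {W : Set X} (h0 : (0 : X) ∈ W)
    (hbal : Balanced ℝ W) (hconv : Convex ℝ W) (hbdd : Bornology.IsBounded W) :
    ∃ (V : Type v) (_ : NormedAddCommGroup V) (_ : NormedSpace ℝ V) (_ : CompleteSpace V)
      (j : V →L[ℝ] X), IsInterpolation W j := by
  let r : ℕ → ℝ := fun n => (2 : ℝ)⁻¹ ^ n
  have hr : ∀ n, 0 < r n := fun n => by positivity
  -- These are the sets `2ⁿ W + 2⁻ⁿ B`; their gauges are norms equivalent to that of `X`, and at
  -- most `2⁻ⁿ` on `W`.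
  let S : ℕ → Set X := fun n => (r n)⁻¹ • W + Metric.ball 0 (r n)
  have hSball : ∀ n, Metric.ball 0 (r n) ⊆ S n := fun n x hx =>
    ⟨0, ⟨0, h0, smul_zero _⟩, x, hx, zero_add x⟩
  have hSnhds : ∀ n, S n ∈ 𝓝 (0 : X) := fun n =>
    mem_of_superset (Metric.ball_mem_nhds 0 (hr n)) (hSball n)
  have hSabs : ∀ n, Absorbent ℝ (S n) := fun n => absorbent_nhds_zero (hSnhds n)
  have hSbal : ∀ n, Balanced ℝ (S n) := fun n =>
    (hbal.smul _).add (by simpa using balanced_ball_zero)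
  have hSconv : ∀ n, Convex ℝ (S n) := fun n => (hconv.smul _).add (convex_ball _ _)
  obtain ⟨R, hR0, hR⟩ := hbdd.exists_pos_norm_le
  have hSbdd : ∀ n, S n ⊆ Metric.closedBall 0 ((r n)⁻¹ * R + r n) := by
    rintro n _ ⟨_, ⟨w, hw, rfl⟩, y, hy, rfl⟩
    rw [mem_closedBall_zero_iff]
    refine (norm_add_le _ _).trans (add_le_add ?_ (mem_ball_zero_iff.1 hy).le)
    change ‖(r n)⁻¹ • w‖ ≤ _
    rw [norm_smul, Real.norm_of_nonneg (inv_nonneg.2 (hr n).le)]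
    exact mul_le_mul_of_nonneg_left (hR w hw) (inv_nonneg.2 (hr n).le)
  let p : ℕ → Seminorm ℝ X := fun n => gaugeSeminorm (hSbal n) (hSconv n) (hSabs n)
  have hpW : ∀ n, ∀ w ∈ W, p n w ≤ r n := fun n w hw => by
    refine gauge_le_of_mem (hr n).le ⟨(r n)⁻¹ • w, ⟨_, ⟨w, hw, rfl⟩, 0, ?_, add_zero _⟩, ?_⟩
    · simpa using hr n
    · exact smul_inv_smul₀ (hr n).ne' w
  have hp : ∀ n x, p n x ≤ (r n)⁻¹ * ‖x‖ := fun n x => by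
    rw [inv_mul_eq_div, le_div_iff₀ (hr n), mul_comm]
    exact mul_gauge_le_norm (hSball n)
  have hp' : ∀ n x, ‖x‖ ≤ ((r n)⁻¹ * R + r n) * p n x := fun n x => by
    have hpos : 0 < (r n)⁻¹ * R + r n := by have := hr n; positivity
    have h := le_gauge_of_subset_closedBall (hSabs n) hpos.le (hSbdd n) (x := x)
    rwa [div_le_iff₀ hpos, mul_comm] at h
  choose Y i1 i2 e he using fun n => exists_renorming (p n) (hp n) (hp' n)
  have hYc : ∀ n, CompleteSpace (Y n) := fun n =>
    (completeSpace_congr (e := (e n).toEquiv) (e n).isUniformEmbedding).1 inferInstance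
  have hcl := isClosed_diagonalSubmodule e
  refine ⟨diagonalSubmodule e, inferInstance, inferInstance, hcl.completeSpace_coe,
    diagonalValue e, diagonalValue_injective e, ⟨2, fun x hx => ?_⟩, fun ε hε => ?_,
    fun ψ ε hε => exists_dual_apply_sub_diagonalValue_le e ψ hε, fun x hx => ?_⟩
  · refine exists_diagonalValue_eq e zero_le_two fun s => ?_
    have hsum : Summable fun n : ℕ => (2 : ℝ)⁻¹ ^ n :=
      summable_geometric_of_lt_one (by norm_num) (by norm_num)
    calc ∑ n ∈ s, ‖e n x‖ ^ 2 ≤ ∑ n ∈ s, (2 : ℝ)⁻¹ ^ n := by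
          refine Finset.sum_le_sum fun n _ => ?_
          rw [he]
          have h1 : r n ≤ 1 := pow_le_one₀ (by norm_num) (by norm_num)
          have h2 := hpW n x hx
          have h3 : 0 ≤ p n x := apply_nonneg _ _
          have h4 : (2 : ℝ)⁻¹ ^ n = r n := rfl
          rw [h4]
          nlinarith
      _ ≤ ∑' n : ℕ, (2 : ℝ)⁻¹ ^ n := hsum.sum_le_tsum s fun n _ => by positivity
      _ = 2 := by rw [tsum_geometric_of_lt_one (by norm_num) (by norm_num)]; norm_num
      _ ≤ 2 ^ 2 := by norm_num
  · obtain ⟨n, hn⟩ := exists_pow_lt_of_lt_one (show 0 < ε / 2 by positivity)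
      (show (2 : ℝ)⁻¹ < 1 by norm_num)
    -- A vector of `j(B_V)` has gauge below `2`, so it equals `b • (2ⁿ w + y)` with `b < 2`. The
    -- factor `b / 2` is absorbed into the balanced set `W`, and the error is at most `2 * 2⁻ⁿ < ε`.
    refine ⟨2 * (r n)⁻¹, by have := hr n; positivity, fun v hv => ?_⟩
    have h1 : gauge (S n) (diagonalValue e v) ≤ 1 := by
      have h := sum_norm_diagonalValue_sq_le e v {n}
      rw [Finset.sum_singleton, he] at h
      have h' : (p n) (diagonalValue e v) ≤ ‖v‖ :=
        le_of_sq_le_sq h (norm_nonneg v)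
      exact h'.trans hv
    have h2 : gauge (S n) (diagonalValue e v) < 2 := by linarith
    obtain ⟨b, hb0, hb, _, ⟨_, ⟨w, hw, rfl⟩, y, hy, rfl⟩, hbx⟩ :=
      exists_lt_of_gauge_lt (hSabs n) h2
    have hbx' : b • ((r n)⁻¹ • w + y) = diagonalValue e v := hbx
    refine ⟨(b / 2) • w, hbal.smul_mem ?_ hw, ?_⟩
    · rw [Real.norm_of_nonneg (by positivity)]
      linarith
    · rw [← hbx']
      have : b • ((r n)⁻¹ • w + y) - (2 * (r n)⁻¹) • (b / 2) • w = b • y := by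
        rw [smul_add, smul_smul, smul_smul]
        have : 2 * (r n)⁻¹ * (b / 2) = b * (r n)⁻¹ := by ring
        rw [this, add_sub_cancel_left]
      rw [this, norm_smul, Real.norm_of_nonneg hb0.le]
      have hy' : ‖y‖ < r n := mem_ball_zero_iff.1 hy
      have hn' : r n < ε / 2 := hn
      nlinarith [norm_nonneg y]
  -- Each partial sum is continuous on `X`, so the bound `1` survives the closure.
  · suffices h : ∀ s : Finset ℕ, ∑ n ∈ s, ‖e n x‖ ^ 2 ≤ 1 ^ 2 by
      obtain ⟨z, hz, -⟩ := exists_diagonalValue_eq e zero_le_one h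
      exact ⟨z, hz⟩
    intro s
    have hclosed : IsClosed {x | ∑ n ∈ s, ‖e n x‖ ^ 2 ≤ 1 ^ 2} :=
      isClosed_le (by fun_prop) continuous_const
    refine closure_minimal ?_ hclosed hx
    rintro _ ⟨v, hv, rfl⟩
    refine (sum_norm_diagonalValue_sq_le e v s).trans ?_
    exact pow_le_pow_left₀ (norm_nonneg v) (mem_closedBall_zero_iff.1 hv) 2

end Interpolation

/-! ### The dual ball as an equicontinuous compact set. -/

section DualBall

variable (X : Type*) [NormedAddCommGroup X] [NormedSpace ℝ X]

/-- The closed unit ball of the dual, as a subset of the weak-star dual. -/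
def dualBall : Set (WeakDual ℝ X) := WeakDual.toStrongDual ⁻¹' Metric.closedBall 0 1

theorem norm_le_one_of_mem_dualBall (φ : dualBall X) :
    ‖WeakDual.toStrongDual (φ : WeakDual ℝ X)‖ ≤ 1 := mem_closedBall_zero_iff.1 φ.2

theorem abs_apply_le_of_mem_dualBall (φ : dualBall X) (x : X) :
    |(φ : WeakDual ℝ X) x| ≤ ‖x‖ := by
  have h := (WeakDual.toStrongDual (φ : WeakDual ℝ X)).le_of_opNorm_le
    (norm_le_one_of_mem_dualBall X φ) x
  simpa using h

theorem isEqc_dualBall : IsEqc (dualBall X) := by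
  refine ⟨WeakDual.isCompact_closedBall 0 1, ?_⟩
  refine Metric.equicontinuous_of_continuity_modulus (fun t => t) tendsto_id _ fun x y φ => ?_
  rw [Real.dist_eq, dist_eq_norm, ← map_sub]
  exact abs_apply_le_of_mem_dualBall X φ (x - y)

instance : CompactSpace (dualBall X) := isCompact_iff_compactSpace.1 (isEqc_dualBall X).1

variable {X}

/-- A functional of norm at most one, as a point of the dual ball. -/
noncomputable def toDualBall (φ : StrongDual ℝ X) (h : ‖φ‖ ≤ 1) : dualBall X :=
  ⟨StrongDual.toWeakDual φ, mem_closedBall_zero_iff.2 h⟩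

theorem exists_eq_smul_dualBall (φ : StrongDual ℝ X) :
    ∃ (c : ℝ) (χ : dualBall X), ∀ x, φ x = c * (χ : WeakDual ℝ X) x := by
  have hpos : 0 < ‖φ‖ + 1 := by positivity
  refine ⟨‖φ‖ + 1, toDualBall ((‖φ‖ + 1)⁻¹ • φ) ?_, fun x => ?_⟩
  · rw [norm_smul, Real.norm_of_nonneg (by positivity), inv_mul_le_iff₀ hpos]
    linarith
  · change φ x = (‖φ‖ + 1) * ((‖φ‖ + 1)⁻¹ * φ x)
    rw [mul_inv_cancel_left₀ hpos.ne']

end DualBall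

/-! ### Transfer of smallness; the Rosenthal case. -/

namespace IsInterpolation

variable {V X : Type*} [NormedAddCommGroup V] [NormedSpace ℝ V]
  [NormedAddCommGroup X] [NormedSpace ℝ X] {W : Set X} {j : V →L[ℝ] X}

theorem exists_dual_abs_approx (hj : IsInterpolation W j) (ψ : StrongDual ℝ V) {ε : ℝ}
    (hε : 0 < ε) : ∃ φ : StrongDual ℝ X, ∀ v, ‖v‖ ≤ 1 → |ψ v - φ (j v)| ≤ ε := by
  obtain ⟨φ, hφ⟩ := hj.exists_dual_approx ψ ε hε
  refine ⟨φ, fun v hv => abs_le.2 ⟨?_, hφ v hv⟩⟩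
  have h := hφ (-v) (by simpa using hv)
  simp only [map_neg] at h
  linarith

/-- The form in which properties of `W` pass to `j(B_V)`: `c` and `w` do not depend on `φ`. -/
theorem exists_abs_approx (hj : IsInterpolation W j) {ε : ℝ} (hε : 0 < ε) :
    ∃ c > (0 : ℝ), ∀ v, ‖v‖ ≤ 1 → ∃ w ∈ W, ∀ φ : dualBall X,
      |(φ : WeakDual ℝ X) (j v) - c * (φ : WeakDual ℝ X) w| ≤ ε := by
  obtain ⟨c, hc, h⟩ := hj.exists_approx ε hε
  refine ⟨c, hc, fun v hv => ?_⟩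
  obtain ⟨w, hw, hvw⟩ := h v hv
  refine ⟨w, hw, fun φ => ?_⟩
  have := (abs_apply_le_of_mem_dualBall X φ (j v - c • w)).trans hvw
  simpa using this

theorem isRosenthalSpace (hj : IsInterpolation W j)
    (hW : IsTameFamily (restrictTo (dualBall X) W)) : IsRosenthalSpace V := by
  intro x hx
  obtain ⟨R, hR0, hR⟩ := hx.exists_pos_norm_le
  set y : ℕ → V := fun n => R⁻¹ • x n with hy
  have hy1 : ∀ n, ‖y n‖ ≤ 1 := fun n => by
    rw [hy, norm_smul, Real.norm_of_nonneg (by positivity), inv_mul_le_iff₀ hR0, mul_one]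
    exact hR _ ⟨n, rfl⟩
  have hxy : ∀ n, x n = R • y n := fun n => (smul_inv_smul₀ hR0.ne' _).symm
  rcases exists_tendsto_subseq_or_independent
    (f := fun n (φ : dualBall X) => (φ : WeakDual ℝ X) (j (y n)))
    (fun φ => ⟨‖j‖, fun n => (abs_apply_le_of_mem_dualBall X φ _).trans
      (j.unit_le_opNorm _ (hy1 n))⟩) with ⟨k, hk, hlim⟩ | ⟨n, a, b, hab, hind⟩
  · refine ⟨k, hk, fun ψ => ?_⟩
    suffices h : CauchySeq fun n => ψ (y (k n)) by
      obtain ⟨l, hl⟩ := cauchySeq_tendsto_of_complete h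
      refine ⟨R * l, ?_⟩
      simpa only [hxy, map_smul, smul_eq_mul] using hl.const_mul R
    rw [Metric.cauchySeq_iff']
    intro ε hε
    obtain ⟨φ, hφ⟩ := hj.exists_dual_abs_approx ψ (show 0 < ε / 4 by positivity)
    obtain ⟨c, χ, hχ⟩ := exists_eq_smul_dualBall φ
    obtain ⟨l, hl⟩ := hlim χ
    have hφl : Tendsto (fun n => φ (j (y (k n)))) atTop (𝓝 (c * l)) := by
      simpa only [hχ] using hl.const_mul c
    obtain ⟨N, hN⟩ := Metric.cauchySeq_iff'.1 hφl.cauchySeq (ε / 4) (by positivity)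
    refine ⟨N, fun n hn => ?_⟩
    have h1 := abs_le.1 (hφ (y (k n)) (hy1 _))
    have h2 := abs_le.1 (hφ (y (k N)) (hy1 _))
    have h3 := hN n hn
    rw [Real.dist_eq, abs_lt] at h3 ⊢
    constructor <;> linarith
  · exfalso
    obtain ⟨c, hc, happ⟩ := hj.exists_abs_approx (show 0 < (b - a) / 4 by linarith)
    choose w hw hwφ using fun k => happ (y (n k)) (hy1 _)
    -- An error of a quarter of the gap leaves the two levels separated; dividing by `c` passes from
    -- `c • w` to `w`.
    refine hW.2 ⟨fun k φ => (φ : WeakDual ℝ X) (w k), fun k => ⟨w k, hw k, rfl⟩,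
      (a + (b - a) / 4) / c, (b - (b - a) / 4) / c, ?_, fun P M hPM => ?_⟩
    · gcongr 1
      linarith
    · obtain ⟨φ, hP, hM⟩ := hind P M hPM
      refine ⟨φ, fun k hk => ?_, fun k hk => ?_⟩
      · rw [lt_div_iff₀ hc]
        have h1 := abs_le.1 (hwφ k φ)
        have h2 := hP k hk
        simp only at h2
        linarith
      · rw [div_lt_iff₀ hc]
        have h1 := abs_le.1 (hwφ k φ)
        have h2 := hM k hk
        simp only at h2
        linarith

end IsInterpolation

/-! ### Fragmentation and the Asplund case. -/

section Fragmentation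

/-- A fragmented family of functions on a compact space which factor through a continuous map to a
second countable Hausdorff space is separable for uniform convergence on the family. -/
theorem IsFragmentedFamily.exists_countable {K Z : Type u} [TopologicalSpace K] [CompactSpace K]
    [TopologicalSpace Z] [T2Space Z] [SecondCountableTopology Z] {F : Set (K → ℝ)}
    (hF : IsFragmentedFamily F) {π : K → Z} (hπ : Continuous π)
    (hfib : ∀ f ∈ F, ∀ x y, π x = π y → f x = f y) {ε : ℝ} (hε : 0 < ε) :
    ∃ T : Set K, T.Countable ∧ ∀ x, ∃ t ∈ T, ∀ f ∈ F, dist (f x) (f t) < ε := by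
  let good : Set Z → Prop := fun A =>
    ∃ T : Set K, T.Countable ∧ ∀ x, π x ∈ A → ∃ t ∈ T, ∀ f ∈ F, dist (f x) (f t) < ε
  let b := TopologicalSpace.countableBasis Z
  have hb := TopologicalSpace.isBasis_countableBasis Z
  -- By countability of the basis, the union of all good basic sets is itself good. It remains to
  -- show that it covers the image of `π`.
  let G : Set Z := ⋃₀ {U ∈ b | good U}
  have hGo : IsOpen G := isOpen_sUnion fun U hU => hb.isOpen hU.1
  obtain ⟨T, hT, hTG⟩ : good G := by
    have hcount : {U ∈ b | good U}.Countable :=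
      (TopologicalSpace.countable_countableBasis Z).mono fun U hU => hU.1
    choose! T hT hTx using fun U (hU : U ∈ {U ∈ b | good U}) => hU.2
    refine ⟨⋃ U ∈ {U ∈ b | good U}, T U, hcount.biUnion hT, ?_⟩
    rintro x ⟨U, hU, hxU⟩
    obtain ⟨t, ht, htf⟩ := hTx U hU x hxU
    exact ⟨t, Set.mem_biUnion hU ht, htf⟩
  refine ⟨T, hT, fun x => hTG x ?_⟩
  by_contra hx
  let D : Set K := π ⁻¹' Gᶜ
  have hDcl : IsClosed D := hGo.isClosed_compl.preimage hπ
  have : CompactSpace D := isCompact_iff_compactSpace.1 hDcl.isCompact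
  let ρ : D → π '' D := fun d => ⟨π d, d, d.2, rfl⟩
  have hρ : Continuous ρ := by fun_prop
  have hρs : Function.Surjective ρ := by
    rintro ⟨_, d, hd, rfl⟩
    exact ⟨⟨d, hd⟩, rfl⟩
  -- Fragmentation gives a set open in `K`, not in `Z`. On a minimal compact set still mapping onto
  -- the image of `D`, removing that open piece uncovers some `z`. Over a neighbourhood of `z`,
  -- every point outside `G` then has a fibre mate in the piece, so `t₀` serves them all.
  obtain ⟨E, hEc, hEs, hEmin⟩ := exists_compact_surjective_zorn_subset hρ hρs
  let E' : Set K := Subtype.val '' E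
  have hE' : IsCompact E' := (isCompact_iff_compactSpace.2 hEc).image continuous_subtype_val
  have hlift : ∀ y ∈ D, ∃ e ∈ E', π e = π y := fun y hy => by
    obtain ⟨d, hd, hdy⟩ : ρ ⟨y, hy⟩ ∈ ρ '' E := by rw [hEs]; trivial
    exact ⟨d, ⟨d, hd, rfl⟩, congrArg Subtype.val hdy⟩
  obtain ⟨e₀, he₀, -⟩ := hlift x hx
  obtain ⟨O, hO, ⟨t₀, ht₀O, ht₀E⟩, hosc⟩ := hF E' ⟨e₀, he₀⟩ ε hε
  obtain ⟨d₀, hd₀, hd₀t⟩ := ht₀E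
  have hne : {e : E | (e : D).1 ∉ O} ≠ Set.univ := fun h => by
    have : (⟨d₀, hd₀⟩ : E) ∈ {e : E | (e : D).1 ∉ O} := h ▸ trivial
    exact this (by simpa [hd₀t] using ht₀O)
  have hcl : IsClosed {e : E | (e : D).1 ∉ O} :=
    hO.isClosed_compl.preimage (continuous_subtype_val.comp continuous_subtype_val)
  obtain ⟨z, hz⟩ := (Set.ne_univ_iff_exists_notMem _).1 (hEmin _ hne hcl)
  have hC : IsClosed (π '' (E' \ O)) := ((hE'.diff hO).image hπ).isClosed
  have hzC : z.1 ∈ (π '' (E' \ O))ᶜ := by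
    rintro ⟨_, ⟨⟨d, hd, rfl⟩, hdO⟩, hdz⟩
    exact hz ⟨⟨d, hd⟩, hdO, Subtype.ext hdz⟩
  obtain ⟨U, hU, hzU, hUC⟩ := hb.exists_subset_of_mem_open hzC hC.isOpen_compl
  have hUgood : good U := by
    refine ⟨insert t₀ T, hT.insert _, fun y hy => ?_⟩
    by_cases hyG : π y ∈ G
    · obtain ⟨t, ht, htf⟩ := hTG y hyG
      exact ⟨t, Or.inr ht, htf⟩
    · obtain ⟨e, he, hey⟩ := hlift y hyG
      have heO : e ∈ O := by
        by_contra heO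
        exact hUC hy ⟨e, ⟨he, heO⟩, hey⟩
      refine ⟨t₀, Or.inl rfl, fun f hf => ?_⟩
      rw [← hfib f hf e y hey]
      exact hosc f hf e ⟨heO, he⟩ t₀ ⟨ht₀O, d₀, hd₀, hd₀t⟩
  obtain ⟨y, hy, hyz⟩ := z.2
  exact hy (hyz ▸ ⟨U, ⟨hU, hUgood⟩, hzU⟩)

variable {V X : Type*} [NormedAddCommGroup V] [NormedSpace ℝ V]
  [NormedAddCommGroup X] [NormedSpace ℝ X] {W : Set X} {j : V →L[ℝ] X}

theorem IsInterpolation.isFragmentedFamily (hj : IsInterpolation W j)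
    (hW : IsFragmentedFamily (restrictTo (dualBall X) W)) :
    IsFragmentedFamily (restrictTo (dualBall X) (j '' Metric.closedBall 0 1)) := by
  intro A hA ε hε
  obtain ⟨c, hc, happ⟩ := hj.exists_abs_approx (show 0 < ε / 4 by positivity)
  obtain ⟨O, hO, hOA, hosc⟩ := hW A hA (ε / (4 * c)) (by positivity)
  refine ⟨O, hO, hOA, ?_⟩
  rintro _ ⟨_, ⟨v, hv, rfl⟩, rfl⟩ φ hφ χ hχ
  obtain ⟨w, hw, hvw⟩ := happ v (mem_closedBall_zero_iff.1 hv)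
  have h1 := abs_le.1 (hvw φ)
  have h2 := abs_le.1 (hvw χ)
  have h3 := hosc _ ⟨w, hw, rfl⟩ φ hφ χ hχ
  rw [Real.dist_eq, lt_div_iff₀ (by positivity)] at h3
  have h4 : |c * (φ : WeakDual ℝ X) w - c * (χ : WeakDual ℝ X) w| < ε / 4 := by
    rw [← mul_sub, abs_mul, abs_of_pos hc]
    linarith
  rw [abs_lt] at h4
  rw [Real.dist_eq, abs_lt]
  constructor <;> linarith

/-- Evaluation at a dense sequence of `S` maps the dual ball to a metrizable space, through which
the unit ball of `S` factors. Hence the functionals induced on `S` by the dual ball form a norm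
separable set, whose span is dense in the dual of `S`. -/
theorem IsInterpolation.isAsplundSpace {V : Type*} {X : Type u} [NormedAddCommGroup V]
    [NormedSpace ℝ V] [NormedAddCommGroup X] [NormedSpace ℝ X] {W : Set X} {j : V →L[ℝ] X}
    (hj : IsInterpolation W j)
    (hW : IsFragmentedFamily (restrictTo (dualBall X) W)) : IsAsplundSpace V := by
  intro S _ _
  let F : Set (dualBall X → ℝ) :=
    restrictTo (dualBall X) ((fun s : S => j s) '' Metric.closedBall 0 1)
  have hFsub : F ⊆ restrictTo (dualBall X) (j '' Metric.closedBall 0 1) := by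
    refine Set.image_mono ?_
    rintro _ ⟨s, hs, rfl⟩
    exact ⟨s, by simpa using hs, rfl⟩
  have hF : IsFragmentedFamily F := fun A hA ε hε => by
    obtain ⟨O, hO, hOA, hosc⟩ := hj.isFragmentedFamily hW A hA ε hε
    exact ⟨O, hO, hOA, fun f hf => hosc f (hFsub hf)⟩
  let s := TopologicalSpace.denseSeq S
  have hs : DenseRange s := TopologicalSpace.denseRange_denseSeq S
  -- `ULift` puts the target in the universe of `X`, as `exists_countable` requires.
  let π : dualBall X → ULift ℕ → ℝ := fun φ n => (φ : WeakDual ℝ X) (j (s n.down))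
  have hπ : Continuous π := continuous_pi fun n =>
    (WeakDual.eval_continuous _).comp continuous_subtype_val
  have hfib : ∀ f ∈ F, ∀ φ χ, π φ = π χ → f φ = f χ := by
    rintro _ ⟨_, ⟨v, -, rfl⟩, rfl⟩ φ χ h
    have hcont : ∀ φ : dualBall X, Continuous fun v : S => (φ : WeakDual ℝ X) (j v) := fun φ =>
      (φ : WeakDual ℝ X).continuous.comp (j.continuous.comp continuous_subtype_val)
    exact congrFun (hs.equalizer (hcont φ) (hcont χ) (funext fun n => congrFun h ⟨n⟩)) v
  let r : dualBall X → StrongDual ℝ S := fun φ =>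
    (WeakDual.toStrongDual (φ : WeakDual ℝ X)).comp (j.comp S.subtypeL)
  have hR : TopologicalSpace.IsSeparable (Set.range r) := by
    choose T hT hTd using fun n : ℕ =>
      hF.exists_countable hπ hfib (ε := 1 / ((n : ℝ) + 1)) (by positivity)
    refine ⟨r '' ⋃ n, T n, (Set.countable_iUnion hT).image r, ?_⟩
    rintro _ ⟨φ, rfl⟩
    refine (SeminormedAddCommGroup.mem_closure_iff (E := StrongDual ℝ S)).2 fun ε hε => ?_
    obtain ⟨n, hn⟩ := exists_nat_one_div_lt hε
    obtain ⟨t, ht, hdist⟩ := hTd n φ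
    refine ⟨r t, ⟨t, Set.mem_iUnion.2 ⟨n, ht⟩, rfl⟩, lt_of_le_of_lt ?_ hn⟩
    refine ContinuousLinearMap.opNorm_le_of_unit_norm (by positivity) fun v hv => ?_
    exact (hdist _ ⟨_, ⟨v, mem_closedBall_zero_iff.2 hv.le, rfl⟩, rfl⟩).le
  have hspan := hR.span (R := ℝ)
  refine TopologicalSpace.isSeparable_univ_iff.1 (hspan.closure.mono fun ψ _ => ?_)
  refine (SeminormedAddCommGroup.mem_closure_iff (E := StrongDual ℝ S)).2 fun ε hε => ?_
  obtain ⟨g, hg⟩ := StrongDual.exists_extension S ψ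
  obtain ⟨φ, hφ⟩ := hj.exists_dual_abs_approx g (show 0 < ε / 2 by positivity)
  obtain ⟨c, χ, hχ⟩ := exists_eq_smul_dualBall φ
  refine ⟨c • r χ, Submodule.smul_mem _ _ (Submodule.subset_span ⟨χ, rfl⟩), ?_⟩
  refine lt_of_le_of_lt ?_ (half_lt_self hε)
  refine ContinuousLinearMap.opNorm_le_of_unit_norm (by positivity) fun v hv => ?_
  have h := hφ v hv.le
  rw [hg, hχ] at h
  exact h

end Fragmentation

/-! ### Double limits and the reflexive case. -/

section Reflexivity

open NormedSpace

/-- If `η` is a norm-preserving extension of `ξ` restricted to the common kernel, then `ξ - η` lies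
in the span of the `L i`. So the restriction has norm `‖η‖ > d`. -/
theorem exists_forall_apply_eq_zero_lt {D ι : Type*} [NormedAddCommGroup D] [NormedSpace ℝ D]
    [Finite ι] (ξ : StrongDual ℝ D) (L : ι → StrongDual ℝ D) {d : ℝ}
    (hd : ∀ η ∈ Submodule.span ℝ (Set.range L), d < ‖ξ - η‖) :
    ∃ φ : D, ‖φ‖ ≤ 1 ∧ (∀ i, L i φ = 0) ∧ d < ξ φ := by
  have := Fintype.ofFinite ι
  let p : Submodule ℝ D := ⨅ i, LinearMap.ker (L i).toLinearMap
  have hp : ∀ φ ∈ p, ∀ i, L i φ = 0 := fun φ hφ i => (Submodule.mem_iInf _).1 hφ i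
  let f : StrongDual ℝ p := ξ.comp p.subtypeL
  have hf : d < ‖f‖ := by
    obtain ⟨η, hη, hηn⟩ := exists_extension_norm_eq p f
    have hker : p ≤ LinearMap.ker (ξ - η).toLinearMap := fun φ hφ => by
      have h := hη ⟨φ, hφ⟩
      change ξ φ - η φ = 0
      rw [h]
      exact sub_self _
    obtain ⟨c, hc⟩ := (Submodule.mem_span_range_iff_exists_fun ℝ).1 (mem_span_of_iInf_ker_le_ker hker)
    have hmem : ξ - η ∈ Submodule.span ℝ (Set.range L) := by
      refine (Submodule.mem_span_range_iff_exists_fun ℝ).2 ⟨c, ?_⟩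
      refine ContinuousLinearMap.coe_injective ?_
      rw [← hc]
      simp
    have h := hd _ hmem
    rwa [sub_sub_cancel, hηn] at h
  obtain ⟨φ, hφ, hfφ⟩ := f.exists_lt_apply_of_lt_opNorm hf
  have hfφ' : d < |ξ φ| := hfφ
  rcases le_total 0 (ξ φ) with h | h
  · exact ⟨φ, hφ.le, hp φ φ.2, by rwa [abs_of_nonneg h] at hfφ'⟩
  · refine ⟨-φ, by simpa using hφ.le, fun i => by simp [hp φ φ.2 i], ?_⟩
    rwa [abs_of_nonpos h, ← map_neg] at hfφ'

/-- **Helly's lemma**, for a functional on the dual at positive distance from the space. -/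
theorem exists_dual_apply_eq_zero_lt {X ι : Type*} [NormedAddCommGroup X] [NormedSpace ℝ X]
    [Finite ι] (ξ : StrongDual ℝ (StrongDual ℝ X)) {d d' : ℝ}
    (hd : ∀ x, d ≤ ‖ξ - inclusionInDoubleDual ℝ X x‖) (hd' : d' < d) (x : ι → X) :
    ∃ φ : StrongDual ℝ X, ‖φ‖ ≤ 1 ∧ (∀ i, φ (x i) = 0) ∧ d' < ξ φ := by
  refine exists_forall_apply_eq_zero_lt ξ (fun i => inclusionInDoubleDual ℝ X (x i)) fun η hη => ?_
  have hrange : Submodule.span ℝ (Set.range fun i => inclusionInDoubleDual ℝ X (x i)) ≤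
      LinearMap.range (inclusionInDoubleDual ℝ X).toLinearMap := by
    rw [Submodule.span_le]
    rintro _ ⟨i, rfl⟩
    exact ⟨x i, rfl⟩
  obtain ⟨y, rfl⟩ := hrange hη
  exact hd'.trans_le (hd y)

theorem exists_pos_forall_le_norm_sub {X D : Type*} [NormedAddCommGroup X] [CompleteSpace X]
    [NormedAddCommGroup D] {J : X → D} (hsub : ∀ x y, J (x - y) = J x - J y)
    (hnorm : ∀ x, ‖J x‖ = ‖x‖) {ξ : D} (hξ : ¬ ∃ x, J x = ξ) : ∃ d > 0, ∀ x, d ≤ ‖ξ - J x‖ := by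
  have hJ : Isometry J := Isometry.of_dist_eq fun x y => by
    rw [dist_eq_norm, dist_eq_norm, ← hsub, hnorm]
  obtain ⟨d, hd, hball⟩ := Metric.isOpen_iff.1 hJ.isClosedEmbedding.isClosed_range.isOpen_compl ξ hξ
  refine ⟨d, hd, fun x => ?_⟩
  by_contra! h
  refine hball (a := J x) ?_ ⟨x, rfl⟩
  rwa [Metric.mem_ball, dist_comm, dist_eq_norm]

theorem surjective_of_closedUnitBall_subset_range {V D : Type*} [SMul ℝ V]
    [NormedAddCommGroup D] [NormedSpace ℝ D] {J : V → D} (hJ : ∀ (c : ℝ) v, J (c • v) = c • J v)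
    (h : ∀ ζ, ‖ζ‖ ≤ 1 → ∃ v, J v = ζ) :
    Function.Surjective J := by
  intro ζ
  have hpos : 0 < ‖ζ‖ + 1 := by positivity
  obtain ⟨v, hv⟩ := h ((‖ζ‖ + 1)⁻¹ • ζ) (by
    rw [norm_smul, Real.norm_of_nonneg (by positivity), inv_mul_le_iff₀ hpos]
    linarith)
  exact ⟨(‖ζ‖ + 1) • v, by rw [hJ, hv, smul_inv_smul₀ hpos.ne']⟩

/-- **Goldstine's theorem**, for finitely many functionals. -/
theorem exists_norm_le_one_abs_sub_lt {V ι : Type*} [NormedAddCommGroup V] [NormedSpace ℝ V]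
    [Finite ι] (ξ : StrongDual ℝ (StrongDual ℝ V)) (hξ : ‖ξ‖ ≤ 1) (ψ : ι → StrongDual ℝ V) {δ : ℝ}
    (hδ : 0 < δ) : ∃ v, ‖v‖ ≤ 1 ∧ ∀ i, |ψ i v - ξ (ψ i)| < δ := by
  classical
  have := Fintype.ofFinite ι
  let L : V →L[ℝ] (ι → ℝ) := ContinuousLinearMap.pi ψ
  by_cases hmem : (fun i => ξ (ψ i)) ∈ closure (L '' Metric.closedBall 0 1)
  · obtain ⟨_, ⟨v, hv, rfl⟩, hdist⟩ := Metric.mem_closure_iff.1 hmem δ hδ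
    refine ⟨v, mem_closedBall_zero_iff.1 hv, fun i => ?_⟩
    have h := (dist_le_pi_dist _ _ i).trans_lt hdist
    rwa [dist_comm] at h
  · exfalso
    have hconv : Convex ℝ (closure (L '' Metric.closedBall 0 1)) :=
      ((convex_closedBall (0 : V) 1).linear_image L.toLinearMap).closure
    obtain ⟨f, u, hfu, huf⟩ := geometric_hahn_banach_closed_point hconv isClosed_closure hmem
    let χ : StrongDual ℝ V := f.comp L
    have hf : ∀ y : ι → ℝ, f y = ∑ i, f (Pi.single i 1) * y i := fun y => by
      conv_lhs => rw [pi_eq_sum_univ' y]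
      simp [mul_comm, Pi.single]
    have hχ : χ = ∑ i, f (Pi.single i 1) • ψ i := by
      ext v
      change f (L v) = _
      rw [hf]
      simp [L]
    have hξχ : ξ χ = f fun i => ξ (ψ i) := by
      rw [hχ, hf]
      simp
    have hlt : ∀ v, ‖v‖ ≤ 1 → χ v < u := fun v hv =>
      hfu _ (subset_closure ⟨v, mem_closedBall_zero_iff.2 hv, rfl⟩)
    have hu : 0 ≤ u := by
      have h := hlt 0 (by simp)
      rw [map_zero] at h
      exact h.le
    have hχn : ‖χ‖ ≤ u := by
      refine ContinuousLinearMap.opNorm_le_of_unit_norm hu fun v hv => abs_le.2 ⟨?_, (hlt v hv.le).le⟩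
      have h := hlt (-v) (by simpa using hv.le)
      rw [map_neg] at h
      linarith
    have h1 : ξ χ ≤ 1 * ‖χ‖ := (le_abs_self _).trans (ξ.le_of_opNorm_le hξ χ)
    linarith

/-- Boundedness allows passing to subsequences along which both iterated limits exist; eventual
bounds survive this. -/
theorem HasDLP.le_of_eventually {K : Type*} {F : Set (K → ℝ)} (hF : HasDLP F) {f : ℕ → K → ℝ}
    {x : ℕ → K} (hf : ∀ n, f n ∈ F) {C : ℝ} (hC : ∀ n m, |f n (x m)| ≤ C) {p q : ℝ}
    (hp : ∀ n, ∀ᶠ m in atTop, f n (x m) ≤ p) (hq : ∀ m, ∀ᶠ n in atTop, q ≤ f n (x m)) :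
    q ≤ p := by
  have hI : IsCompact (Set.Icc (-C) C) := isCompact_Icc
  have hP : IsCompact (Set.univ.pi fun _ : ℕ => Set.Icc (-C) C) := isCompact_univ_pi fun _ => hI
  obtain ⟨β, hβ, k, hk, hkβ⟩ := hP.tendsto_subseq (x := fun n m => f n (x m))
    fun n m _ => abs_le.1 (hC n m)
  obtain ⟨α, hα, l, hl, hlα⟩ := hP.tendsto_subseq (x := fun m n => f (k n) (x m))
    fun m n _ => abs_le.1 (hC (k n) m)
  rw [tendsto_pi_nhds] at hkβ hlα
  obtain ⟨a, -, k', hk', hka⟩ := hI.tendsto_subseq (x := α) fun n => hα n trivial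
  obtain ⟨b, -, l', hl', hlb⟩ := hI.tendsto_subseq (x := β ∘ l) fun n => hβ (l n) trivial
  have hab : a = b := hF (fun n => f (k (k' n))) (fun m => x (l (l' m))) (fun n => hf _)
    (α ∘ k') ((β ∘ l) ∘ l') a b (fun n => (hlα (k' n)).comp hl'.tendsto_atTop) hka
    (fun m => (hkβ (l (l' m))).comp hk'.tendsto_atTop) hlb
  have hap : a ≤ p := le_of_tendsto' hka fun n =>
    le_of_tendsto (hlα (k' n)) (hl.tendsto_atTop.eventually (hp _))
  have hqb : q ≤ b := ge_of_tendsto' hlb fun m =>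
    ge_of_tendsto (hkβ (l (l' m))) (hk.tendsto_atTop.eventually (hq _))
  linarith

variable {V X : Type*} [NormedAddCommGroup V] [NormedSpace ℝ V]
  [NormedAddCommGroup X] [NormedSpace ℝ X] {W : Set X} {j : V →L[ℝ] X}

/-- If the bidual of `j` maps `ζ` to a functional `ξ` at positive distance from `X`, then the double
limit property fails along suitable sequences. -/
theorem exists_seq_triangular {ζ : StrongDual ℝ (StrongDual ℝ V)} (hζ : ‖ζ‖ ≤ 1)
    {ξ : StrongDual ℝ (StrongDual ℝ X)} (hξ : ∀ φ, ξ φ = ζ (φ.comp j)) {d : ℝ} (hd : 0 < d)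
    (hdist : ∀ x, d ≤ ‖ξ - inclusionInDoubleDual ℝ X x‖) :
    ∃ (φ : ℕ → StrongDual ℝ X) (v : ℕ → V), (∀ n, ‖φ n‖ ≤ 1) ∧ (∀ n, ‖v n‖ ≤ 1) ∧
      (∀ n m, n < m → φ m (j (v n)) = 0) ∧ (∀ n m, m ≤ n → 3 / 8 * d ≤ φ m (j (v n))) := by
  have step : ∀ s : Finset (StrongDual ℝ X × V), ∃ (φ : StrongDual ℝ X) (v : V),
      ‖φ‖ ≤ 1 ∧ ‖v‖ ≤ 1 ∧ d / 2 < ξ φ ∧ |φ (j v) - ξ φ| < d / 8 ∧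
      ∀ z ∈ s, φ (j z.2) = 0 ∧ |z.1 (j v) - ξ z.1| < d / 8 := by
    intro s
    obtain ⟨φ, hφ, hφs, hφd⟩ := exists_dual_apply_eq_zero_lt ξ hdist (half_lt_self hd)
      fun z : s => j z.1.2
    -- Here `none` stands for the new functional and `some` for the earlier ones. The final constant
    -- is `3 / 8 = 1 / 2 - 1 / 8`.
    obtain ⟨v, hv, hvs⟩ := exists_norm_le_one_abs_sub_lt ζ hζ
      (fun z : Option s => (z.elim φ fun z => z.1.1).comp j) (show 0 < d / 8 by positivity)
    have h0 : |φ (j v) - ξ φ| < d / 8 := by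
      rw [hξ]
      exact hvs none
    refine ⟨φ, v, hφ, hv, hφd, h0, fun z hz => ⟨hφs ⟨z, hz⟩, ?_⟩⟩
    rw [hξ]
    exact hvs (some ⟨z, hz⟩)
  obtain ⟨z, hz, hzlt⟩ := exists_seq_of_forall_finset_exists
    (fun z : StrongDual ℝ X × V => ‖z.1‖ ≤ 1 ∧ ‖z.2‖ ≤ 1 ∧ d / 2 < ξ z.1 ∧
      |z.1 (j z.2) - ξ z.1| < d / 8)
    (fun z z' => z'.1 (j z.2) = 0 ∧ |z.1 (j z'.2) - ξ z.1| < d / 8) (fun s _ => by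
      obtain ⟨φ, v, h1, h2, h3, h4, h5⟩ := step s
      exact ⟨⟨φ, v⟩, ⟨h1, h2, h3, h4⟩, h5⟩)
  refine ⟨fun n => (z n).1, fun n => (z n).2, fun n => (hz n).1, fun n => (hz n).2.1,
    fun n m h => (hzlt n m h).1, fun n m hmn => ?_⟩
  have h2 : |(z m).1 (j (z n).2) - ξ (z m).1| < d / 8 := by
    rcases hmn.eq_or_lt with rfl | hlt
    · exact (hz m).2.2.2
    · exact (hzlt m n hlt).2
  have h3 := abs_lt.1 h2
  have h4 := (hz m).2.2.1
  linarith

/-- Replacing `j (v n)` by `c • w n` costs `d`, leaving values at most `d` on one side of the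
diagonal and at least `2 * d` on the other. The double limit property would give `2 * d ≤ d`. -/
theorem IsInterpolation.not_exists_seq_triangular (hj : IsInterpolation W j)
    (hW : HasDLP (restrictTo (dualBall X) W)) {d : ℝ} (hd : 0 < d) {φ : ℕ → StrongDual ℝ X}
    {v : ℕ → V} (hφ : ∀ n, ‖φ n‖ ≤ 1) (hv : ∀ n, ‖v n‖ ≤ 1)
    (hlt : ∀ n m, n < m → φ m (j (v n)) = 0) : ¬ ∀ n m, m ≤ n → 3 * d ≤ φ m (j (v n)) := by
  intro hle
  obtain ⟨c, hc, happ⟩ := hj.exists_abs_approx hd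
  choose w hw hwφ using fun n => happ (v n) (hv n)
  have hwφ' : ∀ n m, |φ m (j (v n)) - c * φ m (w n)| ≤ d := fun n m =>
    hwφ n (toDualBall (φ m) (hφ m))
  have hqp := hW.le_of_eventually (f := fun n φ => (φ : WeakDual ℝ X) (w n))
    (x := fun m => toDualBall (φ m) (hφ m))
    (fun n => ⟨w n, hw n, rfl⟩) (C := (‖j‖ + d) / c) (p := d / c) (q := 2 * d / c) ?_ ?_ ?_
  · rw [div_le_div_iff_of_pos_right hc] at hqp
    linarith
  · intro n m
    change |φ m (w n)| ≤ _
    have h1 := abs_le.1 (hwφ' n m)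
    have h2 : |φ m (j (v n))| ≤ 1 * ‖j‖ := ((φ m).le_of_opNorm_le (hφ m) _).trans
      (mul_le_mul_of_nonneg_left (j.unit_le_opNorm _ (hv n)) zero_le_one)
    rw [abs_le] at h2 ⊢
    rw [← neg_div, div_le_iff₀ hc, le_div_iff₀ hc]
    constructor <;> linarith
  · intro n
    filter_upwards [eventually_gt_atTop n] with m hm
    change φ m (w n) ≤ _
    have h1 := abs_le.1 (hwφ' n m)
    rw [hlt n m hm] at h1
    rw [le_div_iff₀ hc]
    linarith
  · intro m
    filter_upwards [eventually_ge_atTop m] with n hn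
    change _ ≤ φ m (w n)
    have h1 := abs_le.1 (hwφ' n m)
    have h2 := hle n m hn
    rw [div_le_iff₀ hc]
    linarith

/-- The bidual of `j` takes its values in `X`, if `W` has the double limit property. -/
theorem IsInterpolation.exists_apply_comp_eq [CompleteSpace X] (hj : IsInterpolation W j)
    (hW : HasDLP (restrictTo (dualBall X) W)) (ζ : StrongDual ℝ (StrongDual ℝ V)) (hζ : ‖ζ‖ ≤ 1) :
    ∃ x : X, ∀ φ : StrongDual ℝ X, ζ (φ.comp j) = φ x := by
  obtain ⟨ξ, hξ⟩ : ∃ ξ : StrongDual ℝ (StrongDual ℝ X), ∀ φ, ξ φ = ζ (φ.comp j) :=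
    ⟨ζ.comp ((ContinuousLinearMap.compL ℝ V X ℝ).flip j), fun φ => rfl⟩
  by_cases hmem : ∃ x, inclusionInDoubleDual ℝ X x = ξ
  · obtain ⟨x, hx⟩ := hmem
    exact ⟨x, fun φ => by rw [← hξ, ← hx, dual_def]⟩
  · obtain ⟨d, hd, hdist⟩ := exists_pos_forall_le_norm_sub (map_sub (inclusionInDoubleDual ℝ X))
      (inclusionInDoubleDualLi (E := X) ℝ).norm_map hmem
    obtain ⟨φ, v, hφ, hv, hlt, hle⟩ := exists_seq_triangular hζ hξ hd hdist
    refine absurd (fun n m h => ?_)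
      (hj.not_exists_seq_triangular hW (show 0 < d / 8 by positivity) hφ hv hlt)
    linarith [hle n m h]

/-- The point `x` representing `ζ` on the functionals `φ ∘ j` lies in `closure (j(B_V))` by
Hahn–Banach, so `x = j v`. Then `ζ` and `v` agree on a norm dense subset of the dual of `V`. -/
theorem IsInterpolation.isReflexiveSpace [CompleteSpace X] (hj : IsInterpolation W j)
    (hW : HasDLP (restrictTo (dualBall X) W)) : IsReflexiveSpace V := by
  refine surjective_of_closedUnitBall_subset_range
    (map_smul (inclusionInDoubleDual ℝ V)) fun ζ hζ => ?_
  obtain ⟨x, hx⟩ := hj.exists_apply_comp_eq hW ζ hζ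
  have hxcl : x ∈ closure (j '' Metric.closedBall 0 1) := by
    by_contra hmem
    have hconv : Convex ℝ (closure (j '' Metric.closedBall 0 1)) :=
      ((convex_closedBall (0 : V) 1).linear_image j.toLinearMap).closure
    obtain ⟨f, u, hfu, huf⟩ := geometric_hahn_banach_closed_point hconv isClosed_closure hmem
    have hlt : ∀ v, ‖v‖ ≤ 1 → f (j v) < u := fun v hv =>
      hfu _ (subset_closure ⟨v, mem_closedBall_zero_iff.2 hv, rfl⟩)
    have hu : 0 ≤ u := by
      have h := hlt 0 (by simp)
      rw [map_zero, map_zero] at h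
      exact h.le
    have hn : ‖f.comp j‖ ≤ u := by
      refine ContinuousLinearMap.opNorm_le_of_unit_norm hu fun v hv =>
        abs_le.2 ⟨?_, (hlt v hv.le).le⟩
      have h := hlt (-v) (by simpa using hv.le)
      rw [map_neg, map_neg] at h
      change -u ≤ f (j v)
      linarith
    have h1 : ζ (f.comp j) ≤ 1 * ‖f.comp j‖ := (le_abs_self _).trans (ζ.le_of_opNorm_le hζ _)
    rw [hx f] at h1
    linarith
  obtain ⟨v, rfl⟩ := hj.closure_image_subset hxcl
  refine ⟨v, ?_⟩
  ext ψ
  rw [dual_def]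
  refine eq_of_forall_dist_le fun ε hε => ?_
  have hpos : 0 < ‖v‖ + 1 := by positivity
  obtain ⟨φ, hφ⟩ := hj.exists_dual_abs_approx ψ (show 0 < ε / (‖v‖ + 1) by positivity)
  have hn : ‖ψ - φ.comp j‖ ≤ ε / (‖v‖ + 1) :=
    ContinuousLinearMap.opNorm_le_of_unit_norm (by positivity) fun v hv => hφ v hv.le
  have h1 := (ψ - φ.comp j).le_of_opNorm_le hn v
  have h2 := ζ.le_of_opNorm_le hζ (ψ - φ.comp j)
  rw [map_sub, hx] at h2
  rw [Real.dist_eq]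
  have h3 : ψ v - ζ ψ = (ψ - φ.comp j) v - (ζ ψ - φ (j v)) := by simp
  rw [h3]
  refine (abs_sub _ _).trans ?_
  rw [Real.norm_eq_abs] at h1 h2
  calc _ ≤ ε / (‖v‖ + 1) * ‖v‖ + 1 * (ε / (‖v‖ + 1)) :=
        add_le_add h1 (h2.trans (mul_le_mul_of_nonneg_left hn zero_le_one))
    _ = ε := by field_simp

end Reflexivity

/-! ### Factorization through the interpolation space. -/

section Factorization

variable {K : Type*} {A B : Set (K → ℝ)}

theorem IsTameFamily.mono (h : IsTameFamily B) (hAB : A ⊆ B) : IsTameFamily A :=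
  ⟨h.1.imp fun _ hC f hf => hC f (hAB hf), fun ⟨f, hf, hi⟩ => h.2 ⟨f, fun n => hAB (hf n), hi⟩⟩

theorem IsFragmentedFamily.mono [TopologicalSpace K] (h : IsFragmentedFamily B) (hAB : A ⊆ B) :
    IsFragmentedFamily A := fun S hS ε hε =>
  (h S hS ε hε).imp fun _ hO => ⟨hO.1, hO.2.1, fun f hf => hO.2.2 f (hAB hf)⟩

theorem HasDLP.mono (h : HasDLP B) (hAB : A ⊆ B) : HasDLP A :=
  fun f x hf => h f x fun n => hAB (hf n)

variable {E : Type*} [AddCommGroup E] [Module ℝ E] [TopologicalSpace E]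
  [IsTopologicalAddGroup E] [ContinuousSMul ℝ E]

/-- As `U` is absorbent, `T` takes values in the range of `j`; injectivity makes `j⁻¹ T` linear, and
its boundedness on `U` makes it continuous. -/
theorem IsInterpolation.factorsThrough {V X : Type*} [NormedAddCommGroup V] [NormedSpace ℝ V]
    [NormedAddCommGroup X] [NormedSpace ℝ X] {j : V →L[ℝ] X} {T : E →L[ℝ] X} {U : Set E}
    (hU : U ∈ 𝓝 0) (hj : IsInterpolation (T '' U) j) : FactorsThrough T V := by
  obtain ⟨C, hC⟩ := hj.exists_preimage
  have hrange : ∀ x, T x ∈ LinearMap.range j.toLinearMap := fun x => by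
    obtain ⟨r, hr, hx⟩ := ((absorbent_nhds_zero hU : Absorbent ℝ U) x).exists_pos
    obtain ⟨y, hy, rfl⟩ := Set.singleton_subset_iff.1 (hx r (le_abs_self r))
    obtain ⟨v, hv, -⟩ := hC (T y) ⟨y, hy, rfl⟩
    exact ⟨r • v, by simp [hv]⟩
  let u₀ : E →ₗ[ℝ] V := (LinearEquiv.ofInjective j.toLinearMap hj.injective).symm.toLinearMap.comp
    (T.toLinearMap.codRestrict _ hrange)
  have hu₀ : ∀ x, j (u₀ x) = T x := fun x =>
    LinearEquiv.ofInjective_symm_apply (f := j.toLinearMap) (h := hj.injective) ⟨T x, hrange x⟩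
  have hbdd : Bornology.IsVonNBounded ℝ (u₀ '' U) := by
    refine (NormedSpace.isVonNBounded_closedBall ℝ V C).subset ?_
    rintro _ ⟨x, hx, rfl⟩
    obtain ⟨v, hv, hvC⟩ := hC (T x) ⟨x, hx, rfl⟩
    rw [hj.injective ((hu₀ x).trans hv.symm)]
    exact mem_closedBall_zero_iff.2 hvC
  exact ⟨u₀.clmOfExistsBoundedImage ⟨U, hU, hbdd⟩, j, ContinuousLinearMap.ext fun x => (hu₀ x).symm⟩

/-- An operator which is bounded on a neighbourhood of zero factors through an interpolation space
of the image of a smaller neighbourhood. -/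
theorem exists_isInterpolation_factorsThrough [LocallyConvexSpace ℝ E] {X : Type v}
    [NormedAddCommGroup X] [NormedSpace ℝ X] [CompleteSpace X] (T : E →L[ℝ] X) {U : Set E}
    (hU : U ∈ 𝓝 0) (hb : Bornology.IsVonNBounded ℝ (T '' U)) :
    ∃ (W : Set X) (V : Type v) (_ : NormedAddCommGroup V) (_ : NormedSpace ℝ V)
      (_ : CompleteSpace V) (j : V →L[ℝ] X),
      W ⊆ T '' U ∧ IsInterpolation W j ∧ FactorsThrough T V := by
  obtain ⟨U', ⟨hU', hbal, hconv⟩, hsub⟩ := (nhds_hasBasis_absConvex ℝ E).mem_iff.1 hU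
  have hbal' : Balanced ℝ (T '' U') := by
    rintro a ha _ ⟨_, ⟨x, hx, rfl⟩, rfl⟩
    exact ⟨a • x, hbal.smul_mem ha hx, map_smul T a x⟩
  have hWsub : T '' U' ⊆ T '' U := Set.image_mono hsub
  obtain ⟨V, i₁, i₂, i₃, j, hj⟩ := exists_isInterpolation (W := T '' U')
    ⟨0, mem_of_mem_nhds hU', map_zero T⟩ hbal'
    (hconv.linear_image T.toLinearMap) ((NormedSpace.isVonNBounded_iff ℝ).1 (hb.subset hWsub))
  exact ⟨_, V, i₁, i₂, i₃, j, hWsub, hj, hj.factorsThrough hU'⟩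

end Factorization

theorem theoremt
    {E : Type u} [AddCommGroup E] [Module ℝ E] [TopologicalSpace E]
    [IsTopologicalAddGroup E] [ContinuousSMul ℝ E] [LocallyConvexSpace ℝ E]
    {X : Type v} [NormedAddCommGroup X] [NormedSpace ℝ X] [CompleteSpace X]
    (T : E →L[ℝ] X) :
    (IsTameOperator T →
      ∃ (V : Type v) (_ : NormedAddCommGroup V) (_ : NormedSpace ℝ V) (_ : CompleteSpace V),
        IsRosenthalSpace V ∧ FactorsThrough T V) ∧
    (IsNPOperator T →
      ∃ (V : Type v) (_ : NormedAddCommGroup V) (_ : NormedSpace ℝ V) (_ : CompleteSpace V),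
        IsAsplundSpace V ∧ FactorsThrough T V) ∧
    (IsDLPOperator T →
      ∃ (V : Type v) (_ : NormedAddCommGroup V) (_ : NormedSpace ℝ V) (_ : CompleteSpace V),
        IsReflexiveSpace V ∧ FactorsThrough T V) := by
  refine ⟨?_, ?_, ?_⟩ <;> rintro ⟨U, hU, hb, hT⟩ <;>
    obtain ⟨W, V, i₁, i₂, i₃, j, hW, hj, hfac⟩ := exists_isInterpolation_factorsThrough T hU hb <;>
    have hK := (hT _ (isEqc_dualBall X)).mono (Set.image_mono hW)
  · exact ⟨V, i₁, i₂, i₃, hj.isRosenthalSpace hK, hfac⟩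
  · exact ⟨V, i₁, i₂, i₃, hj.isAsplundSpace hK, hfac⟩
  · exact ⟨V, i₁, i₂, i₃, hj.isReflexiveSpace hK, hfac⟩
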